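/- **Notation.** Let $\mathbb R_+=[0,\infty)$, let $X$ be a real Banach space with dual $X^*$, and let $B(\cdot,r)$ and $B[\cdot,r]$ denote open and closed balls. Distances to sets take values in $[0,\infty]$, with $d(\cdot,\emptyset)=+\infty$. A function $\varphi:\mathbb R_+\to\mathbb R_+$ is *admissible* if it is nondecreasing, $\varphi(0)=0$, and $\varphi(t_n)\to0$ implies $t_n\to0$ for every sequence $(t_n)$ in $\mathbb R_+$. For convex $\varphi$, let $\varphi'_+(t)=\lim_{s\downarrow0}\frac{\varphi(t+s)-\varphi(t)}{s}$ for $t\ge 0$. For a proper lower semicontinuous $f:X\to\mathbb R\cup\{+\infty\}$, $x\in\operatorname{dom}f=\{f<+\infty\}$ and $h\in X$, let $$f^\uparrow(x,h)=\lim_{\varepsilon\downarrow0}\ \limsup_{u\to x,\ f(u)\to f(x),\ t\downarrow0}\ \inf_{w\in B[h,\varepsilon]}\frac{f(u+tw)-f(u)}{t},$$ and let $\partial f(x)=\{x^*\in X^*:\langle x^*,h\rangle\le f^\uparrow(x,h)\ \ \forall h\in X\}$ be the Clarke–Rockafellar subdifferential; set $\partial f(x)=\emptyset$ if $f(x)=+\infty$.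 For $\psi:\mathbb R_+\to\mathbb R_+$ (with $\psi(+\infty)=+\infty$), the set-valued map $\partial f$ is *strongly metrically $\psi$-regular at $(\bar x,0)$* if $0\in\partial f(\bar x)$ and there exist $r,\tau,\kappa,\delta\in(0,\infty)$ such that $$\psi\big(\tau\, d(x,(\partial f)^{-1}(u^*))\big)\le\kappa\, d(u^*,\partial f(x))\qquad\forall x\in B(\bar x,r),\ \forall u^*\in B(0,r)\subset X^*,$$ and $(\partial f)^{-1}(u^*)\cap B(\bar x,\delta)$ is a singleton for every $u^*\in B(0,r)$. For $u^*\in X^*$ let $f_{u^*}(x)=f(x)-\langle u^*,x\rangle$. The function $f$ *has stable local well-posedness at $\bar x\in\operatorname{dom}f$ with respect to $\varphi$* ($\varphi$-SLWP) if there exist $\delta,r,\tau,\kappa\in(0,\infty)$ such that for every $u^*\in B(0,\delta)\subset X^*$ there is $x_{u^*}\in B[\bar x,r]\cap\operatorname{dom} f$, with $x_0=\bar x$, satisfying $$\varphi(\kappa\|x-x_{u^*}\|)\le\tau\big(f_{u^*}(x)-f_{u^*}(x_{u^*})\big)\qquad\forall x\in B[\bar x,r].$$ **Theorem 3.3.**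 Let $\varphi:\mathbb R_+\to\mathbb R_+$ be a convex admissible function, let $f:X\to\mathbb R\cup\{+\infty\}$ be a proper lower semicontinuous function on a Banach space $X$, and let $\bar x\in\operatorname{dom}f$ be a local minimizer of $f$. If $\partial f$ is strongly metrically $\varphi'_+$-regular at $(\bar x,0)$, then $f$ has $\varphi$-SLWP at $\bar x$. -/

import Mathlib

open Set Filter Topology
open scoped ENNReal

namespace TiltStability

noncomputable section

/-- Admissible functions `φ : ℝ₊ → ℝ₊`. A function on `ℝ₊ = [0, ∞)` is represented by a function on
`ℝ` of which only the values on `Ici 0` are ever used. -/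
structure IsAdmissible (φ : ℝ → ℝ) : Prop where
  nonneg : ∀ t, 0 ≤ t → 0 ≤ φ t
  monotoneOn : MonotoneOn φ (Ici 0)
  map_zero : φ 0 = 0
  tendsto_zero : ∀ t : ℕ → ℝ, (∀ n, 0 ≤ t n) →
    Tendsto (fun n => φ (t n)) atTop (𝓝 0) → Tendsto t atTop (𝓝 0)

/-- The right derivative `φ'₊(t) = lim_{s ↓ 0} (φ (t + s) - φ t) / s`. For `t ≥ 0` it depends on
the values of `φ` on `[t, ∞)` only. -/
def rightDeriv (φ : ℝ → ℝ) (t : ℝ) : ℝ := derivWithin φ (Ioi t) t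

/-- A function `ψ : ℝ₊ → ℝ₊` evaluated on an extended nonnegative number, with `ψ(∞) = ∞`. -/
def extend (ψ : ℝ → ℝ) (t : ℝ≥0∞) : ℝ≥0∞ :=
  if t = ⊤ then ⊤ else ENNReal.ofReal (ψ t.toReal)

section Multifunction

variable {X Y : Type*} [PseudoEMetricSpace X] [PseudoEMetricSpace Y]

/-- The inequality `ψ (τ d(x, F⁻¹(y))) ≤ κ d(y, F(x))`. Distances to sets are `[0, ∞]`-valued, so
that the distance to the empty set is `∞`. -/
def RegularityIneq (ψ : ℝ → ℝ) (F : X → Set Y) (τ κ : ℝ) (x : X) (y : Y) : Prop :=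
  extend ψ (ENNReal.ofReal τ * Metric.infEDist x {z | y ∈ F z}) ≤
    ENNReal.ofReal κ * Metric.infEDist y (F x)

end Multifunction

section Regularity

variable {X Y : Type*} [NormedAddCommGroup X] [NormedAddCommGroup Y]

/-- Strong metric `ψ`-regularity of the multifunction `F` at a point `(xbar, ybar)` of its graph. -/
def StronglyMetricallyRegular (ψ : ℝ → ℝ) (F : X → Set Y) (xbar : X) (ybar : Y) : Prop :=
  ybar ∈ F xbar ∧
    ∃ r τ κ δ : ℝ, 0 < r ∧ 0 < τ ∧ 0 < κ ∧ 0 < δ ∧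
      (∀ x ∈ Metric.ball xbar r, ∀ y ∈ Metric.ball ybar r, RegularityIneq ψ F τ κ x y) ∧
      ∀ y ∈ Metric.ball ybar r, ∃ z, {x | y ∈ F x} ∩ Metric.ball xbar δ = {z}

end Regularity

section Functions

variable {X : Type*} [NormedAddCommGroup X] [NormedSpace ℝ X]

/-- `f : X → ℝ ∪ {+∞}` is proper: it never takes the value `-∞` and is somewhere finite. -/
def IsProper (f : X → EReal) : Prop := (∀ x, f x ≠ ⊥) ∧ ∃ x, f x ≠ ⊤

/-- The filter of `u → x` with `f u → f x`. -/
def nhdsVal (f : X → EReal) (x : X) : Filter X := 𝓝 x ⊓ comap f (𝓝 (f x))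

/-- `limsup_{u →_f x, t ↓ 0} inf_{w ∈ h + ε B} (f (u + t w) - f u) / t`. -/
def upperQuotient (f : X → EReal) (x h : X) (ε : ℝ) : EReal :=
  limsup (fun p : X × ℝ => ⨅ w ∈ Metric.closedBall h ε, (f (p.1 + p.2 • w) - f p.1) / (p.2 : EReal))
    (nhdsVal f x ×ˢ 𝓝[>] (0 : ℝ))

/-- Rockafellar's generalized directional derivative `f↑(x, h)`, the limit of `upperQuotient` as
`ε ↓ 0`. By monotonicity in `ε` this limit is a supremum, see `tendsto_upperQuotient`. -/
def rockafellarDeriv (f : X → EReal) (x h : X) : EReal :=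
  ⨆ ε : Ioi (0 : ℝ), upperQuotient f x h ε

theorem upperQuotient_antitone (f : X → EReal) (x h : X) : Antitone (upperQuotient f x h) := by
  intro a b hab
  refine limsup_le_limsup (Eventually.of_forall fun p => ?_)
  exact biInf_mono fun w hw => Metric.closedBall_subset_closedBall hab hw

theorem tendsto_upperQuotient (f : X → EReal) (x h : X) :
    Tendsto (upperQuotient f x h) (𝓝[>] 0) (𝓝 (rockafellarDeriv f x h)) := by
  have := (upperQuotient_antitone f x h).tendsto_nhdsGT 0
  rwa [sSup_image'] at this

/-- The Clarke–Rockafellar subdifferential; it is empty outside the effective domain. -/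
def clarkeSubdiff (f : X → EReal) (x : X) : Set (StrongDual ℝ X) :=
  {u | f x ≠ ⊤ ∧ ∀ h : X, ((u h : ℝ) : EReal) ≤ rockafellarDeriv f x h}

/-- The tilted function `f - u`. -/
def tilt (f : X → EReal) (u : StrongDual ℝ X) (x : X) : EReal := f x - ((u x : ℝ) : EReal)

/-- Stable local well-posedness of `f` at `xbar` with respect to `φ`; `s u` is the point `x_u`. The
requirement `f (s u) ≠ ⊤` makes the difference of function values meaningful. -/
def HasSLWP (φ : ℝ → ℝ) (f : X → EReal) (xbar : X) : Prop :=
  f xbar ≠ ⊤ ∧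
    ∃ δ r τ κ : ℝ, 0 < δ ∧ 0 < r ∧ 0 < τ ∧ 0 < κ ∧
      ∃ s : StrongDual ℝ X → X, s 0 = xbar ∧
        ∀ u ∈ Metric.ball (0 : StrongDual ℝ X) δ,
          s u ∈ Metric.closedBall xbar r ∧ f (s u) ≠ ⊤ ∧
            ∀ x ∈ Metric.closedBall xbar r,
              ((φ (κ * ‖x - s u‖) : ℝ) : EReal) ≤ (τ : EReal) * (tilt f u x - tilt f u (s u))

end Functions

end

end TiltStability

/-! As `φ` is convex with `φ 0 = 0`, `φ s ≤ s * φ'₊(t)` for `0 < s ≤ t`. Let `z` be the critical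
point of `f - u` near `xbar`. Metric regularity then says: if some subgradient at `v` is within `ε`
of `u`, then `φ s ≤ s * κ * ε` for all `0 < s ≤ τ * dist v z`.

Growth: suppose `z` minimizes `f - u` on a ball, and let `x` at distance `d` from `z` have value gap
`e`. Up to an arbitrarily small increase of `e`, Ekeland with radius `d / 2` gives `v` with `dist v
z ≥ d / 2` and a subgradient within `2 * e / d` of `u`. Taking `s = τ * d / 2`, the factors `d`
cancel and `φ (τ * d / 2) ≤ τ * κ * e`.

For `u = 0` this applies to `xbar`. For small `u`, regularity at `xbar` puts `z` near `xbar`, and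
growth at `xbar` keeps near-minimizers of `f - u` off a sphere. Ekeland turns them into almost
critical points, which converge to `z`; lower semicontinuity makes `z` a minimizer, so the growth
argument applies at `z`. -/

namespace TiltStability

/-! ### Ekeland's variational principle -/

/-- Ekeland's variational principle. -/
theorem exists_ekeland_point {M : Type*} [MetricSpace M] [CompleteSpace M] {F : M → ℝ}
    (hF : LowerSemicontinuous F) (hb : BddBelow (range F)) {ε : ℝ} (hε : 0 < ε) (x₀ : M) :
    ∃ v, F v + ε * dist x₀ v ≤ F x₀ ∧ ∀ w, F v ≤ F w + ε * dist v w := by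
  have step : ∀ (x : M) (n : ℕ), ∃ y, F y + ε * dist x y ≤ F x ∧
      ∀ z, F z + ε * dist x z ≤ F x → F y ≤ F z + (1 / 2) ^ n := by
    intro x n
    have hne : (F '' {y | F y + ε * dist x y ≤ F x}).Nonempty := ⟨F x, x, by simp, rfl⟩
    obtain ⟨_, ⟨y, hy, rfl⟩, hlt⟩ := Real.lt_sInf_add_pos hne (ε := (1 / 2) ^ n) (by positivity)
    refine ⟨y, hy, fun z hz => hlt.le.trans ?_⟩
    gcongr
    exact csInf_le (hb.mono (image_subset_range _ _)) ⟨z, hz, rfl⟩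
  choose g hg hg' using step
  let x : ℕ → M := fun n => Nat.rec x₀ (fun k y => g y k) n
  have hx : ∀ n, x (n + 1) = g (x n) n := fun n => rfl
  have htrans : ∀ {a b c}, F b + ε * dist a b ≤ F a → F c + ε * dist b c ≤ F b →
      F c + ε * dist a c ≤ F a := by
    intro a b c h₁ h₂
    nlinarith [dist_triangle a b c]
  have hdesc : ∀ n k, F (x (n + k)) + ε * dist (x n) (x (n + k)) ≤ F (x n) := by
    intro n k
    induction k with
    | zero => simp
    | succ k ih => exact htrans ih (hg (x (n + k)) (n + k))
  -- Each iterate nearly minimizes `F` over the set of competitors below its predecessor, so the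
  -- sets below the iterates shrink to a point.
  have hsmall : ∀ n y, F y + ε * dist (x (n + 1)) y ≤ F (x (n + 1)) →
      dist (x (n + 1)) y ≤ (1 / 2) ^ n / ε := by
    intro n y hy
    have h := hg' (x n) n y (htrans (hg (x n) n) hy)
    rw [le_div_iff₀ hε]
    rw [← hx] at h
    linarith
  have hlim : Tendsto (fun n : ℕ => (1 / 2 : ℝ) ^ n / ε) atTop (𝓝 0) := by
    simpa using (tendsto_pow_atTop_nhds_zero_of_lt_one (r := (1 / 2 : ℝ)) (by norm_num)
      (by norm_num)).div_const ε
  have hcau : CauchySeq fun n => x (n + 1) := by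
    refine cauchySeq_of_le_tendsto_0' (fun n => (1 / 2 : ℝ) ^ n / ε) (fun n m hnm => ?_) hlim
    obtain ⟨k, rfl⟩ := Nat.exists_eq_add_of_le hnm
    apply hsmall
    have := hdesc (n + 1) k
    rwa [show n + 1 + k = n + k + 1 by ring] at this
  obtain ⟨v, hv⟩ := cauchySeq_tendsto_of_complete hcau
  have hvx : ∀ n, F v + ε * dist (x n) v ≤ F (x n) := by
    intro n
    have hlsc : LowerSemicontinuous fun y => F y + ε * dist (x n) y :=
      hF.add (by fun_prop : Continuous fun y => ε * dist (x n) y).lowerSemicontinuous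
    refine (hlsc.isClosed_preimage (F (x n))).mem_of_tendsto hv ?_
    filter_upwards [eventually_ge_atTop n] with m hm
    obtain ⟨k, hk⟩ := Nat.exists_eq_add_of_le (hm.trans m.le_succ)
    change F (x (m + 1)) + _ ≤ _
    rw [show m + 1 = n + k from hk]
    exact hdesc n k
  refine ⟨v, hvx 0, fun w => ?_⟩
  by_contra! hw
  have hwx : ∀ n, dist (x (n + 1)) w ≤ (1 / 2) ^ n / ε := fun n =>
    hsmall n w (htrans (hvx (n + 1)) hw.le)
  have hxw : Tendsto (fun n => x (n + 1)) atTop (𝓝 w) :=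
    tendsto_iff_dist_tendsto_zero.2 (squeeze_zero (fun _ => dist_nonneg) hwx hlim)
  obtain rfl := tendsto_nhds_unique hv hxw
  simp at hw

/-! ### Clarke–Rockafellar subdifferential and an approximate Fermat rule -/

section Subdifferential

variable {X : Type*} [NormedAddCommGroup X] [NormedSpace ℝ X]

/-- A sandwich theorem: a convex cone in `X × ℝ` lying above `u - ε ‖·‖` lies above a continuous
linear functional at distance at most `ε` from `u`. -/
theorem exists_dual_le_of_cone {S : Set (X × ℝ)} (h0 : (0, 0) ∈ S)
    (hadd : ∀ p ∈ S, ∀ q ∈ S, p + q ∈ S) (hsmul : ∀ c : ℝ, 0 < c → ∀ p ∈ S, c • p ∈ S)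
    (u : StrongDual ℝ X) {ε : ℝ} (hε : 0 ≤ ε) (hS : ∀ p ∈ S, u p.1 - ε * ‖p.1‖ ≤ p.2) :
    ∃ y : StrongDual ℝ X, ‖y - u‖ ≤ ε ∧ ∀ p ∈ S, y p.1 ≤ p.2 := by
  -- `N` is the infimal convolution of `ε * ‖·‖` with the lower boundary of `S` tilted by `-u`. It
  -- is finite by `hS` and sublinear because `S` is a convex cone. Hahn–Banach gives a linear `g ≤
  -- N`; the apex of `S` yields `g ≤ ε * ‖·‖`, and `h = p.1` yields the bound on `S`.
  let T : X → S → ℝ := fun h s => s.1.2 - u s.1.1 + ε * ‖h - s.1.1‖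
  let N : X → ℝ := fun h => ⨅ s : S, T h s
  have : Nonempty S := ⟨⟨_, h0⟩⟩
  have hbdd : ∀ h, BddBelow (range (T h)) := by
    refine fun h => ⟨-(ε * ‖h‖), ?_⟩
    rintro _ ⟨⟨s, hs⟩, rfl⟩
    have h₁ := hS s hs
    have h₂ : ‖s.1‖ ≤ ‖h - s.1‖ + ‖h‖ := by
      simpa using norm_sub_le h (h - s.1) |>.trans_eq (add_comm _ _)
    have := mul_le_mul_of_nonneg_left h₂ hε
    simp only [T]
    linarith
  have hNle : ∀ h s, N h ≤ T h s := fun h s => ciInf_le (hbdd h) s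
  have hNsmul : ∀ c : ℝ, 0 < c → ∀ h, N (c • h) ≤ c * N h := by
    intro c hc h
    rw [← div_le_iff₀' hc]
    refine le_ciInf fun s => ?_
    rw [div_le_iff₀' hc]
    refine (hNle _ ⟨_, hsmul c hc s.1 s.2⟩).trans_eq ?_
    simp only [T, Prod.smul_fst, Prod.smul_snd, ← smul_sub, norm_smul, Real.norm_eq_abs,
      abs_of_pos hc, map_smul, smul_eq_mul]
    ring
  obtain ⟨g, -, hg⟩ := exists_extension_of_le_sublinear (⊥ : X →ₗ.[ℝ] ℝ) N
    (fun c hc h => by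
      refine (hNsmul c hc h).antisymm ?_
      have := hNsmul c⁻¹ (inv_pos.2 hc) (c • h)
      rwa [inv_smul_smul₀ hc.ne', ← div_eq_inv_mul, le_div_iff₀' hc] at this)
    (fun x y => by
      refine le_ciInf_add_ciInf fun s t => ?_
      refine (hNle _ ⟨_, hadd s.1 s.2 t.1 t.2⟩).trans ?_
      have : ‖x + y - (s.1.1 + t.1.1)‖ ≤ ‖x - s.1.1‖ + ‖y - t.1.1‖ := by
        rw [add_sub_add_comm]; exact norm_add_le _ _
      have := mul_le_mul_of_nonneg_left this hε
      simp only [T, Prod.fst_add, Prod.snd_add, map_add]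
      linarith)
    (by
      rintro ⟨x, hx⟩
      obtain rfl : x = 0 := (Submodule.mem_bot ℝ).1 hx
      have h1 : (⊥ : X →ₗ.[ℝ] ℝ) ⟨0, hx⟩ = 0 := (⊥ : X →ₗ.[ℝ] ℝ).map_zero
      rw [h1]
      refine le_ciInf fun s => ?_
      have := hS s.1 s.2
      simp only [T, zero_sub, norm_neg]
      linarith)
  have hgε : ∀ h, g h ≤ ε * ‖h‖ := fun h => by
    simpa [T] using (hg h).trans (hNle h ⟨_, h0⟩)
  let g' : StrongDual ℝ X := g.mkContinuous ε fun h => by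
    rw [Real.norm_eq_abs, abs_le]
    refine ⟨?_, hgε h⟩
    have := hgε (-h)
    rw [map_neg, norm_neg] at this
    linarith
  refine ⟨u + g', ?_, fun p hp => ?_⟩
  · simpa using g.mkContinuous_norm_le hε _
  · have := (hg p.1).trans (hNle p.1 ⟨p, hp⟩)
    simp only [T, sub_self, norm_zero, mul_zero, add_zero] at this
    change u p.1 + g p.1 ≤ p.2
    linarith

section Rockafellar

variable {f : X → EReal} {x : X}

theorem eventually_nhdsVal_ne_top {X : Type*} [NormedAddCommGroup X] {f : X → EReal} {x : X}
    (hx : f x ≠ ⊤) : ∀ᶠ p in nhdsVal f x, f p ≠ ⊤ :=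
  (tendsto_comap.mono_left inf_le_right : Tendsto f (nhdsVal f x) (𝓝 (f x))).eventually_ne hx

/-- A form free of quotients and limsups; the slack `b > a` absorbs the passage from limsup to
eventual bounds. -/
theorem rockafellarDeriv_le_iff (hbot : ∀ z, f z ≠ ⊥) (hx : f x ≠ ⊤) {h : X} {a : ℝ} :
    rockafellarDeriv f x h ≤ a ↔ ∀ ε > 0, ∀ b > a, ∀ᶠ p in nhdsVal f x ×ˢ 𝓝[>] (0 : ℝ),
      ∃ w ∈ Metric.closedBall h ε, f (p.1 + p.2 • w) ≤ f p.1 + ((p.2 * b : ℝ) : EReal) := by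
  have key : ∀ b : ℝ, ∀ᶠ p in nhdsVal f x ×ˢ 𝓝[>] (0 : ℝ), ∀ w : X,
      (f (p.1 + p.2 • w) - f p.1) / (p.2 : EReal) ≤ b ↔
        f (p.1 + p.2 • w) ≤ f p.1 + ((p.2 * b : ℝ) : EReal) := by
    intro b
    filter_upwards [(eventually_nhdsVal_ne_top hx).prod_mk self_mem_nhdsWithin]
      with p ⟨hp, ht⟩ w
    have ht' : (0 : EReal) < (p.2 : EReal) := EReal.coe_pos.2 ht
    rw [EReal.div_le_iff_le_mul ht' (EReal.coe_ne_top _), EReal.coe_mul,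
      EReal.sub_le_iff_le_add (.inl (hbot _)) (.inl hp), add_comm (f p.1)]
  unfold rockafellarDeriv
  rw [iSup_le_iff]
  constructor
  · intro H ε hε b hb
    have h1 := eventually_lt_of_limsup_lt ((H ⟨ε, hε⟩).trans_lt (EReal.coe_lt_coe_iff.2 hb))
    filter_upwards [h1, key b] with p hp hk
    obtain ⟨w, hw, hlt⟩ := by simpa only [iInf_lt_iff] using hp
    exact ⟨w, hw, (hk w).1 hlt.le⟩
  · rintro H ⟨ε, hε⟩
    refine EReal.le_of_forall_lt_iff_le.1 fun b hb => ?_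
    refine limsup_le_of_le (by isBoundedDefault) ?_
    filter_upwards [H ε hε b (EReal.coe_lt_coe_iff.1 hb), key b] with p hp hk
    obtain ⟨w, hw, hle⟩ := hp
    exact (biInf_le _ hw).trans ((hk w).2 hle)

theorem rockafellarDeriv_zero_le (hbot : ∀ z, f z ≠ ⊥) (hx : f x ≠ ⊤) :
    rockafellarDeriv f x 0 ≤ (0 : ℝ) := by
  rw [rockafellarDeriv_le_iff hbot hx]
  intro ε hε b hb
  have h0 : ∀ᶠ t in 𝓝[>] (0 : ℝ), 0 < t := self_mem_nhdsWithin
  filter_upwards [h0.prod_inr (nhdsVal f x)] with p hp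
  refine ⟨0, by simpa using hε.le, ?_⟩
  rw [smul_zero, add_zero]
  exact le_add_of_nonneg_right (EReal.coe_nonneg.2 (mul_pos hp hb).le)

theorem rockafellarDeriv_smul_le (hbot : ∀ z, f z ≠ ⊥) (hx : f x ≠ ⊤) {h : X} {a c : ℝ}
    (hc : 0 < c) (ha : rockafellarDeriv f x h ≤ a) :
    rockafellarDeriv f x (c • h) ≤ ((c * a : ℝ) : EReal) := by
  rw [rockafellarDeriv_le_iff hbot hx] at ha ⊢
  intro ε hε b hb
  have h1 := ha (ε / c) (div_pos hε hc) (b / c) ((lt_div_iff₀' hc).2 hb)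
  have ht : Tendsto (fun t : ℝ => c * t) (𝓝[>] 0) (𝓝[>] 0) := by
    refine tendsto_nhdsWithin_iff.2 ⟨?_, ?_⟩
    · exact ((continuous_const_mul c).tendsto' 0 0 (mul_zero c)).mono_left nhdsWithin_le_nhds
    · filter_upwards [self_mem_nhdsWithin] with t ht using mul_pos hc ht
  have h2 := (tendsto_id.prodMap ht).eventually h1
  filter_upwards [h2] with p hp
  obtain ⟨w, hw, hle⟩ := hp
  refine ⟨c • w, ?_, ?_⟩
  · rw [mem_closedBall_iff_norm] at hw ⊢
    rw [← smul_sub, norm_smul, Real.norm_eq_abs, abs_of_pos hc]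
    exact (le_div_iff₀' hc).1 hw
  · simp only [Prod.map, id] at hle
    rwa [mul_comm c, mul_smul, mul_assoc, mul_div_cancel₀ _ hc.ne'] at hle

/-- Two increments are chained: first along `h`, then along `k` from the intermediate point. That
point must be close to `x` in value too: the first increment bounds its value above, lower
semicontinuity below. -/
theorem rockafellarDeriv_add_le (hbot : ∀ z, f z ≠ ⊥) (hx : f x ≠ ⊤)
    (hlsc : LowerSemicontinuousAt f x) {h k : X} {a b : ℝ}
    (ha : rockafellarDeriv f x h ≤ a) (hb : rockafellarDeriv f x k ≤ b) :
    rockafellarDeriv f x (h + k) ≤ ((a + b : ℝ) : EReal) := by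
  rw [rockafellarDeriv_le_iff hbot hx] at ha hb ⊢
  intro ε hε c hc
  obtain ⟨η, hη, hηc⟩ : ∃ η > 0, (a + η) + (b + η) = c := ⟨(c - (a + b)) / 2, by linarith, by ring⟩
  have h1 := ha (ε / 2) (half_pos hε) (a + η) (by linarith)
  have h2 := hb (ε / 2) (half_pos hε) (b + η) (by linarith)
  obtain ⟨P, hP, Q, hQ, hPQ⟩ := eventually_prod_iff.1 h2
  obtain ⟨U, hU, V, hV, hUV⟩ := mem_inf_iff_superset.1 hP
  obtain ⟨V', hV', hVV'⟩ := hV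
  obtain ⟨r, hr⟩ : ∃ r : ℝ, f x = r := ⟨(f x).toReal, (EReal.coe_toReal hx (hbot x)).symm⟩
  obtain ⟨l, m, hlm, hIoo⟩ := (mem_nhds_iff_exists_Ioo_subset' ⟨⊥, by simp [hr]⟩
    ⟨⊤, by simp [hr]⟩).1 hV'
  obtain ⟨ρ, hρ, hball⟩ := Metric.mem_nhds_iff.1 (inter_mem hU (hlsc l hlm.1))
  have hfst : Tendsto (fun p : X × ℝ => p.1) (nhdsVal f x ×ˢ 𝓝[>] (0 : ℝ)) (𝓝 x) :=
    tendsto_fst.mono_right inf_le_left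
  have hsnd : Tendsto (fun p : X × ℝ => p.2) (nhdsVal f x ×ˢ 𝓝[>] (0 : ℝ)) (𝓝 0) :=
    tendsto_snd.mono_right nhdsWithin_le_nhds
  have hval : Tendsto (fun p : X × ℝ => f p.1) (nhdsVal f x ×ˢ 𝓝[>] (0 : ℝ)) (𝓝 (f x)) :=
    (tendsto_comap.mono_left inf_le_right).comp tendsto_fst
  have hm : ∀ᶠ p in nhdsVal f x ×ˢ 𝓝[>] (0 : ℝ), f p.1 + ((p.2 * (a + η) : ℝ) : EReal) < m := by
    have h3 : Tendsto (fun p : X × ℝ => ((p.2 * (a + η) : ℝ) : EReal))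
        (nhdsVal f x ×ˢ 𝓝[>] (0 : ℝ)) (𝓝 ((0 : ℝ) : EReal)) := by
      refine (continuous_coe_real_ereal.tendsto 0).comp ?_
      simpa using hsnd.mul_const (a + η)
    have h4 := (EReal.continuousAt_add (p := (f x, ((0 : ℝ) : EReal))) (by simp) (by simp)).tendsto.comp
      (hval.prodMk_nhds h3)
    refine h4.eventually_lt_const ?_
    simpa using hlm.2
  have hd : ∀ᶠ p in nhdsVal f x ×ˢ 𝓝[>] (0 : ℝ), dist p.1 x + p.2 * (‖h‖ + ε / 2) < ρ := by
    refine Tendsto.eventually_lt_const (v := dist x x + 0 * (‖h‖ + ε / 2)) (by simpa using hρ) ?_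
    exact (hfst.dist tendsto_const_nhds).add (hsnd.mul_const _)
  have hpos : ∀ᶠ t in 𝓝[>] (0 : ℝ), 0 < t := self_mem_nhdsWithin
  filter_upwards [h1, hm, hd, (hpos.and hQ).prod_inr (nhdsVal f x)]
    with ⟨y, t⟩ ⟨w, hw, hwle⟩ hym hyd ⟨ht, htQ⟩
  simp only at hwle hym hyd ht htQ ⊢
  have hw' : ‖w‖ ≤ ‖h‖ + ε / 2 := by
    have := norm_le_norm_add_norm_sub' w h
    rw [mem_closedBall_iff_norm] at hw
    linarith
  have hmem : y + t • w ∈ Metric.ball x ρ := by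
    rw [Metric.mem_ball]
    calc dist (y + t • w) x ≤ dist (y + t • w) y + dist y x := dist_triangle _ _ _
      _ = t * ‖w‖ + dist y x := by
        rw [dist_self_add_left, norm_smul, Real.norm_eq_abs, abs_of_pos ht]
      _ ≤ t * (‖h‖ + ε / 2) + dist y x := by gcongr
      _ < ρ := by linarith
  obtain ⟨hyU, hyl⟩ := hball hmem
  have hyP : P (y + t • w) := hUV ⟨hyU, hVV' (hIoo ⟨hyl, hwle.trans_lt hym⟩)⟩
  obtain ⟨w', hw'', hwle'⟩ := hPQ hyP htQ
  refine ⟨w + w', ?_, ?_⟩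
  · rw [mem_closedBall_iff_norm] at hw hw'' ⊢
    rw [add_sub_add_comm]
    exact (norm_add_le _ _).trans (by linarith)
  · simp only at hwle'
    rw [smul_add, ← add_assoc]
    refine hwle'.trans ((add_le_add_left hwle _).trans_eq ?_)
    rw [add_assoc, ← EReal.coe_add, ← mul_add, hηc]

/-- If `f - u + ε ‖· - x‖` has a local minimum at `x`, then `f↑(x, ·) ≥ u - ε ‖·‖`. -/
theorem le_of_rockafellarDeriv_le (hbot : ∀ z, f z ≠ ⊥) (hx : f x ≠ ⊤) {u : StrongDual ℝ X} {ε : ℝ}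
    (hε : 0 ≤ ε)
    (hmin : ∀ᶠ w in 𝓝 x, f x + ((u (w - x) - ε * ‖w - x‖ : ℝ) : EReal) ≤ f w) {h : X} {a : ℝ}
    (ha : rockafellarDeriv f x h ≤ a) : u h - ε * ‖h‖ ≤ a := by
  rw [rockafellarDeriv_le_iff hbot hx] at ha
  -- The base point stays at `x`. Replacing `h` by `w` costs `‖u‖ * η` in `u` and `ε * η` in the
  -- norm; the last `η` is the slack in `a`.
  have key : ∀ η > 0, u h - ε * ‖h‖ ≤ a + (‖u‖ + ε + 1) * η := by
    intro η hη
    obtain ⟨ρ, hρ, hball⟩ := Metric.eventually_nhds_iff.1 hmin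
    have hx' : Tendsto (fun t : ℝ => (x, t)) (𝓝[>] 0) (nhdsVal f x ×ˢ 𝓝[>] (0 : ℝ)) := by
      refine Tendsto.prodMk (tendsto_inf.2 ⟨tendsto_const_nhds, ?_⟩) tendsto_id
      exact tendsto_comap_iff.2 tendsto_const_nhds
    have hd : ∀ᶠ t in 𝓝[>] (0 : ℝ), t * (‖h‖ + η) < ρ := by
      refine Tendsto.eventually_lt_const (v := 0 * (‖h‖ + η)) (by simpa using hρ) ?_
      exact (tendsto_id.mono_left nhdsWithin_le_nhds).mul_const _
    have hpos : ∀ᶠ t in 𝓝[>] (0 : ℝ), 0 < t := self_mem_nhdsWithin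
    obtain ⟨t, ⟨w, hw, hwle⟩, htd, ht⟩ :=
      ((hx'.eventually (ha η hη (a + η) (by linarith))).and (hd.and hpos)).exists
    simp only at hwle
    rw [mem_closedBall_iff_norm] at hw
    have hw' : ‖w‖ ≤ ‖h‖ + η := by
      have := norm_le_norm_add_norm_sub' w h
      linarith
    have hnorm : ‖t • w‖ = t * ‖w‖ := by rw [norm_smul, Real.norm_eq_abs, abs_of_pos ht]
    have h1 := (hball (y := x + t • w) (by
      rw [dist_self_add_left, hnorm]
      exact (mul_le_mul_of_nonneg_left hw' ht.le).trans_lt htd)).trans hwle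
    obtain ⟨r, hr⟩ : ∃ r : ℝ, f x = r := ⟨(f x).toReal, (EReal.coe_toReal hx (hbot x)).symm⟩
    rw [hr, add_sub_cancel_left, hnorm, map_smul, smul_eq_mul, ← EReal.coe_add, ← EReal.coe_add,
      EReal.coe_le_coe_iff] at h1
    have h2 : u w - ε * ‖w‖ ≤ a + η := by
      refine le_of_mul_le_mul_left ?_ ht
      linarith
    have h3 : u h - u w ≤ ‖u‖ * η := by
      rw [← map_sub]
      refine (le_abs_self _).trans ((u.le_opNorm _).trans ?_)
      rw [norm_sub_rev]
      gcongr
    have h4 := mul_le_mul_of_nonneg_left hw' hε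
    linarith
  refine le_of_forall_pos_le_add fun e he => ?_
  have hK : 0 < ‖u‖ + ε + 1 := by positivity
  simpa [mul_div_cancel₀ _ hK.ne'] using key (e / (‖u‖ + ε + 1)) (div_pos he hK)

/-- If `f - u + ε ‖· - x‖` has a local minimum at `x`, then `u` is within `ε` of `∂f(x)`. -/
theorem exists_mem_clarkeSubdiff_norm_sub_le (hbot : ∀ z, f z ≠ ⊥) (hx : f x ≠ ⊤)
    (hlsc : LowerSemicontinuousAt f x) {u : StrongDual ℝ X} {ε : ℝ} (hε : 0 ≤ ε)
    (hmin : ∀ᶠ w in 𝓝 x, f x + ((u (w - x) - ε * ‖w - x‖ : ℝ) : EReal) ≤ f w) :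
    ∃ y ∈ clarkeSubdiff f x, ‖y - u‖ ≤ ε := by
  obtain ⟨y, hy, hS⟩ := exists_dual_le_of_cone
    (S := {p : X × ℝ | rockafellarDeriv f x p.1 ≤ (p.2 : EReal)})
    (rockafellarDeriv_zero_le hbot hx)
    (fun p hp q hq => rockafellarDeriv_add_le hbot hx hlsc hp hq)
    (fun c hc p hp => rockafellarDeriv_smul_le hbot hx hc hp)
    u hε (fun p hp => le_of_rockafellarDeriv_le hbot hx hε hmin hp)
  refine ⟨y, ⟨hx, fun h => EReal.le_of_forall_lt_iff_le.1 fun a ha => ?_⟩, hy⟩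
  exact EReal.coe_le_coe_iff.2 (hS (h, a) ha.le)

end Rockafellar

end Subdifferential

/-! ### Convexity and metric regularity -/

theorem le_mul_rightDeriv {φ : ℝ → ℝ} (hconv : ConvexOn ℝ (Ici (0 : ℝ)) φ) (h0 : φ 0 = 0)
    {s t : ℝ} (hs : 0 < s) (hst : s ≤ t) : φ s ≤ s * rightDeriv φ t := by
  have hint : ∀ {a : ℝ}, 0 < a → a ∈ interior (Ici (0 : ℝ)) := fun ha => by simpa using ha
  have h1 : slope φ 0 s ≤ derivWithin φ (Iio s) s :=
    hconv.slope_le_leftDeriv_of_mem_interior self_mem_Ici (hint hs) hs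
  have h2 := hconv.leftDeriv_le_rightDeriv_of_mem_interior (hint hs)
  have h3 : rightDeriv φ s ≤ rightDeriv φ t :=
    hconv.monotoneOn_rightDeriv (hint hs) (hint (hs.trans_le hst)) hst
  rw [slope_def_field, h0, sub_zero, sub_zero, div_le_iff₀ hs] at h1
  have h4 : derivWithin φ (Iio s) s ≤ rightDeriv φ t := h2.trans h3
  nlinarith

theorem IsAdmissible.pos {φ : ℝ → ℝ} (hφ : IsAdmissible φ) {t : ℝ} (ht : 0 < t) : 0 < φ t := by
  refine (hφ.nonneg t ht.le).lt_of_ne fun h => ht.ne ?_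
  exact tendsto_nhds_unique (hφ.tendsto_zero (fun _ => t) (fun _ => ht.le) (by simp [← h]))
    tendsto_const_nhds

section Regularity

variable {X Y : Type*} [NormedAddCommGroup X] [NormedAddCommGroup Y] {φ ψ : ℝ → ℝ} {F : X → Set Y}
  {τ κ δ : ℝ} {c x z : X} {y : Y}

/-- The distance from `x` to `F⁻¹(y)` is attained at `z`: other preimages lie outside the `δ`-ball,
at least `2δ/3` from `x`, while `dist x z ≤ 2δ/3`. -/
theorem RegularityIneq.le_of_mem (hψ : ∀ s t, 0 < s → s ≤ t → φ s ≤ s * ψ t) (hτ : 0 < τ)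
    (hκ : 0 < κ) (hreg : RegularityIneq ψ F τ κ x y)
    (hz : {w | y ∈ F w} ∩ Metric.ball c δ = {z}) (hxδ : dist x c ≤ δ / 3) (hzδ : dist z c ≤ δ / 3)
    {y' : Y} (hy' : y' ∈ F x) {ε : ℝ} (hε : ‖y' - y‖ ≤ ε) {s : ℝ} (hs : 0 < s)
    (hsx : s ≤ τ * dist x z) : φ s ≤ s * (κ * ε) := by
  have hzm : z ∈ {w | y ∈ F w} := (hz.ge rfl).1
  have hinf : Metric.infEDist x {w | y ∈ F w} = ENNReal.ofReal (dist x z) := by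
    rw [← edist_dist]
    refine (Metric.infEDist_le_edist_of_mem hzm).antisymm (Metric.le_infEDist.2 fun w hw => ?_)
    by_cases hwc : w ∈ Metric.ball c δ
    · obtain rfl : w = z := hz.le ⟨hw, hwc⟩
      rfl
    · rw [edist_dist, edist_dist]
      refine ENNReal.ofReal_le_ofReal ?_
      rw [Metric.mem_ball, not_lt] at hwc
      have h1 := dist_triangle_right x z c
      have h2 := dist_triangle_left w c x
      linarith
  have hd : Metric.infEDist y (F x) ≤ ENNReal.ofReal ε := by
    refine (Metric.infEDist_le_edist_of_mem hy').trans ?_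
    rw [edist_comm, edist_dist, dist_eq_norm]
    exact ENNReal.ofReal_le_ofReal hε
  have h := hreg.trans (mul_le_mul_right hd _)
  rw [hinf, ← ENNReal.ofReal_mul hτ.le, ← ENNReal.ofReal_mul hκ.le, extend,
    if_neg ENNReal.ofReal_ne_top, ENNReal.toReal_ofReal (by positivity), ENNReal.ofReal_le_ofReal_iff
      (mul_nonneg hκ.le ((norm_nonneg _).trans hε))] at h
  exact (hψ s _ hs hsx).trans (mul_le_mul_of_nonneg_left h hs.le)

/-- If `z` were at distance at least `η`, so would be all of `F⁻¹(y)`, and regularity at `c` would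
contradict `hφ`. -/
theorem RegularityIneq.dist_lt (hψ : ∀ s t, 0 < s → s ≤ t → φ s ≤ s * ψ t) (hτ : 0 < τ)
    (hκ : 0 < κ) (hreg : RegularityIneq ψ F τ κ c y)
    (hz : {w | y ∈ F w} ∩ Metric.ball c δ = {z}) {y' : Y} (hy' : y' ∈ F c) {η : ℝ} (hη : 0 < η)
    (hηδ : η ≤ δ) (hφ : τ * η * (κ * dist y y') < φ (τ * η)) : dist z c < η := by
  have hτη : 0 < τ * η := mul_pos hτ hη
  have h := hreg.trans (mul_le_mul_right (Metric.infEDist_le_edist_of_mem hy') _)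
  rw [edist_dist, ← ENNReal.ofReal_mul hκ.le] at h
  by_contra! hlt
  have hle : ENNReal.ofReal η ≤ Metric.infEDist c {w | y ∈ F w} := by
    refine Metric.le_infEDist.2 fun w hw => ?_
    rw [edist_comm, edist_dist]
    refine ENNReal.ofReal_le_ofReal ?_
    by_contra! hwη
    obtain rfl : w = z := hz.le ⟨hw, hwη.trans_le hηδ⟩
    exact hwη.not_ge hlt
  have htop : ENNReal.ofReal τ * Metric.infEDist c {w | y ∈ F w} ≠ ⊤ := by
    intro htop
    rw [extend, if_pos htop] at h
    exact ENNReal.ofReal_ne_top (top_le_iff.1 h)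
  rw [extend, if_neg htop, ENNReal.ofReal_le_ofReal_iff (by positivity)] at h
  have hs : τ * η ≤ (ENNReal.ofReal τ * Metric.infEDist c {w | y ∈ F w}).toReal := by
    rw [← ENNReal.ofReal_le_iff_le_toReal htop, ENNReal.ofReal_mul hτ.le]
    exact mul_le_mul_right hle _
  exact hφ.not_ge ((hψ _ _ hτη hs).trans (mul_le_mul_of_nonneg_left h hτη.le))

end Regularity

/-! ### Growth and minimality of tilted functions -/

variable {X : Type*} [NormedAddCommGroup X] [NormedSpace ℝ X] {f : X → EReal}

/-- Ekeland's principle for `f - u` on a closed ball, in terms of the subdifferential of `f`. -/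
theorem exists_clarkeSubdiff_near [CompleteSpace X] (hbot : ∀ z, f z ≠ ⊥)
    (hlsc : LowerSemicontinuous f) {c x₀ : X} {R m e l : ℝ} (u : StrongDual ℝ X)
    (hm : ∀ x ∈ Metric.closedBall c R, ((m + u x : ℝ) : EReal) ≤ f x)
    (hx₀ : x₀ ∈ Metric.closedBall c R) (hfx₀ : f x₀ ≤ ((m + u x₀ + e : ℝ) : EReal))
    (he : 0 < e) (hl : 0 < l) :
    ∃ v ∈ Metric.closedBall c R, dist v x₀ ≤ l ∧ f v ≤ ((m + u v + e : ℝ) : EReal) ∧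
      (v ∈ Metric.ball c R → ∃ y ∈ clarkeSubdiff f v, ‖y - u‖ ≤ e / l) := by
  have hcl : ∀ q : ℝ, IsClosed {x | f x ≤ ((q + u x : ℝ) : EReal)} := fun q =>
    (lowerSemicontinuous_iff_isClosed_epigraph.1 hlsc).preimage
      (continuous_id.prodMk (continuous_coe_real_ereal.comp (by fun_prop)))
  -- On this closed sublevel set `f` is real-valued. Nothing is lost: in the ball but off `D`, `f -
  -- u` exceeds its value at `v`.
  let D : Set X := Metric.closedBall c R ∩ {x | f x ≤ ((m + e + u x : ℝ) : EReal)}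
  have hDcl : IsClosed D := Metric.isClosed_closedBall.inter (hcl _)
  have : CompleteSpace D := hDcl.completeSpace_coe
  have hreal : ∀ x ∈ D, f x = (((f x).toReal : ℝ) : EReal) := fun x hx =>
    (EReal.coe_toReal (ne_top_of_le_ne_top (EReal.coe_ne_top _) hx.2) (hbot x)).symm
  let F : D → ℝ := fun x => (f x).toReal - u x
  have hFle : ∀ (x : D) (q : ℝ), F x ≤ q ↔ f x ≤ ((q + u x : ℝ) : EReal) := by
    intro x q
    rw [hreal x x.2, EReal.coe_le_coe_iff, ← sub_le_iff_le_add]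
  have hleF : ∀ x : D, m ≤ F x := by
    intro x
    have h := hm x x.2.1
    rw [hreal x x.2, EReal.coe_le_coe_iff] at h
    simp only [F]
    linarith
  have hF : LowerSemicontinuous F := by
    refine lowerSemicontinuous_iff_isClosed_preimage.2 fun q => ?_
    have : F ⁻¹' Iic q = Subtype.val ⁻¹' {x | f x ≤ ((q + u x : ℝ) : EReal)} := by
      ext x
      exact hFle x q
    rw [this]
    exact (hcl q).preimage continuous_subtype_val
  have hx₀D : x₀ ∈ D := ⟨hx₀, by rwa [mem_ofPred_eq, add_right_comm]⟩
  obtain ⟨⟨v, hvD⟩, hv, hvmin⟩ := exists_ekeland_point hF ⟨m, by rintro _ ⟨x, rfl⟩; exact hleF x⟩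
    (div_pos he hl) ⟨x₀, hx₀D⟩
  have hvr := hreal v hvD
  have hvle := (hFle ⟨v, hvD⟩ _).2 hvD.2
  refine ⟨v, hvD.1, ?_, by simpa only [mem_ofPred_eq, add_right_comm] using hvD.2, fun hvb => ?_⟩
  · have h1 := (hFle ⟨x₀, hx₀D⟩ _).2 hx₀D.2
    have h2 : e / l * dist x₀ v ≤ e := by
      have := hleF ⟨v, hvD⟩
      rw [Subtype.dist_eq] at hv
      linarith
    rw [div_mul_eq_mul_div, div_le_iff₀ hl] at h2
    rw [dist_comm]
    exact le_of_mul_le_mul_left h2 he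
  · have hvtop : f v ≠ ⊤ := by rw [hvr]; exact EReal.coe_ne_top _
    refine exists_mem_clarkeSubdiff_norm_sub_le hbot hvtop (hlsc v) (div_pos he hl).le ?_
    filter_upwards [Metric.isOpen_ball.mem_nhds hvb] with w hw
    rw [hvr, ← EReal.coe_add, map_sub]
    have hpos : 0 ≤ e / l * ‖w - v‖ := by positivity
    by_cases hwD : w ∈ D
    · have h := hvmin ⟨w, hwD⟩
      rw [Subtype.dist_eq, dist_comm, dist_eq_norm] at h
      rw [hreal w hwD, EReal.coe_le_coe_iff]
      simp only [F] at h
      linarith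
    · have h : ((m + e + u w : ℝ) : EReal) < f w := by
        by_contra! h
        exact hwD ⟨Metric.ball_subset_closedBall hw, h⟩
      refine le_trans (EReal.coe_le_coe_iff.2 ?_) h.le
      simp only [F] at hvle
      linarith

/-- Growth of `f - u` around a minimizer `z` over a ball. -/
theorem growth_of_isMinOn [CompleteSpace X] (hbot : ∀ z, f z ≠ ⊥) (hlsc : LowerSemicontinuous f)
    {φ : ℝ → ℝ} (h0 : φ 0 = 0) {c z : X} {R τ κ a : ℝ} (hR : 0 < R) (hτ : 0 < τ) (hκ : 0 < κ)
    (u : StrongDual ℝ X)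
    (hreg : ∀ v ∈ Metric.ball c (3 * R), ∀ y ∈ clarkeSubdiff f v, ∀ ε s, ‖y - u‖ ≤ ε → 0 < s →
      s ≤ τ * dist v z → φ s ≤ s * (κ * ε))
    (hz : z ∈ Metric.closedBall c R) (hfz : f z = a)
    (hmin : ∀ x ∈ Metric.closedBall c (3 * R), ((a + u (x - z) : ℝ) : EReal) ≤ f x)
    {x : X} (hx : x ∈ Metric.closedBall c R) {b : ℝ} (hfx : f x = b) :
    φ (τ / 2 * ‖x - z‖) ≤ τ * κ * (b - u x - (a - u z)) := by
  rcases eq_or_ne x z with rfl | hxz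
  · rw [hfx, EReal.coe_eq_coe_iff] at hfz
    simp [h0, hfz]
  have hd : 0 < dist x z := dist_pos.2 hxz
  have hsub : Metric.closedBall c R ⊆ Metric.closedBall c (3 * R) :=
    Metric.closedBall_subset_closedBall (by linarith)
  have he0 : 0 ≤ b - u x - (a - u z) := by
    have := hmin x (hsub hx)
    rw [hfx, EReal.coe_le_coe_iff, map_sub] at this
    linarith
  have key : ∀ η > 0, φ (τ / 2 * ‖x - z‖) ≤ τ * κ * (b - u x - (a - u z) + η) := by
    intro η hη
    obtain ⟨v, -, hvx, -, hvy⟩ := exists_clarkeSubdiff_near hbot hlsc (m := a - u z)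
      (e := b - u x - (a - u z) + η) u
      (fun x hx => by simpa only [map_sub, sub_add_eq_add_sub, add_sub_assoc] using hmin x hx)
      (hsub hx) (by rw [hfx, EReal.coe_le_coe_iff]; linarith) (by linarith) (half_pos hd)
    rw [Metric.mem_closedBall] at hx hz
    -- `dist x z ≤ 2 * R`, so the Ekeland radius is at most `R` and `v` is within `2 * R` of `c`.
    have hvc : v ∈ Metric.ball c (3 * R) := by
      rw [Metric.mem_ball]
      have h1 := dist_triangle v x c
      have h2 := dist_triangle_right x z c
      linarith
    obtain ⟨y, hy, hyu⟩ := hvy hvc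
    have hvz : dist x z / 2 ≤ dist v z := by
      have := dist_triangle_left x z v
      linarith
    have := hreg v hvc y hy _ (τ / 2 * dist x z) hyu (by positivity)
      ((by ring : τ / 2 * dist x z = τ * (dist x z / 2)).trans_le
        (mul_le_mul_of_nonneg_left hvz hτ.le))
    rw [← dist_eq_norm]
    refine this.trans_eq ?_
    field_simp
  refine le_of_forall_pos_le_add fun e he => ?_
  have hK : 0 < τ * κ := mul_pos hτ hκ
  have := key (e / (τ * κ)) (div_pos he hK)
  rwa [mul_add, mul_div_cancel₀ _ hK.ne'] at this

/-- If `f` grows around `c`, then for small `u` the critical point `z` of `f - u` near `c` is a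
minimizer of `f - u`. -/
theorem isMinOn_of_growth [CompleteSpace X] (hbot : ∀ z, f z ≠ ⊥) (hlsc : LowerSemicontinuous f)
    {φ : ℝ → ℝ} (hφ : IsAdmissible φ) {c z : X} {R τ κ α C a : ℝ} (hR : 0 < R) (hτ : 0 < τ)
    (hα : 0 < α) (hC : 0 < C) (u : StrongDual ℝ X) (hfc : f c = a)
    (hgrowth : ∀ x ∈ Metric.closedBall c R, ∀ b : ℝ, f x = b → φ (α * ‖x - c‖) ≤ C * (b - a))
    (hu : C * (‖u‖ * R) < φ (α * R))
    (hreg : ∀ v ∈ Metric.ball c R, ∀ y ∈ clarkeSubdiff f v, ∀ ε s, ‖y - u‖ ≤ ε → 0 < s →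
      s ≤ τ * dist v z → φ s ≤ s * (κ * ε)) {x : X} (hx : x ∈ Metric.closedBall c R) :
    f z + ((u (x - z) : ℝ) : EReal) ≤ f x := by
  have hux : ∀ w ∈ Metric.closedBall c R, u w - u c ≤ ‖u‖ * R := by
    intro w hw
    rw [← map_sub]
    rw [mem_closedBall_iff_norm] at hw
    exact (le_abs_self _).trans ((u.le_opNorm _).trans (by gcongr))
  -- `sInf T` is the infimum of `f - u` over the ball, as a real number.
  let T : Set ℝ := {t | ∃ w ∈ Metric.closedBall c R, f w ≤ ((t + u w : ℝ) : EReal)}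
  have hcT : a - u c ∈ T := ⟨c, Metric.mem_closedBall_self hR.le, by simp [hfc]⟩
  have hTb : BddBelow T := by
    refine ⟨a - u c - ‖u‖ * R, ?_⟩
    rintro t ⟨w, hw, hwt⟩
    have hwr := EReal.coe_toReal (ne_top_of_le_ne_top (EReal.coe_ne_top _) hwt) (hbot w)
    have h1 := hgrowth w hw _ hwr.symm
    have h2 := hφ.nonneg (α * ‖w - c‖) (by positivity)
    have h3 : 0 ≤ (f w).toReal - a := nonneg_of_mul_nonneg_right (h2.trans h1) hC
    rw [← hwr, EReal.coe_le_coe_iff] at hwt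
    linarith [hux w hw]
  have hm : ∀ w ∈ Metric.closedBall c R, ((sInf T + u w : ℝ) : EReal) ≤ f w := by
    intro w hw
    by_cases hw' : f w = ⊤
    · simp [hw']
    have hwr := EReal.coe_toReal hw' (hbot w)
    rw [← hwr, EReal.coe_le_coe_iff, ← le_sub_iff_add_le]
    exact csInf_le hTb ⟨w, hw, by rw [sub_add_cancel, hwr]⟩
  -- By growth, `f - u` on the sphere exceeds its value at `c` by at least `γ`, so points with gap
  -- below `γ` are interior.
  obtain ⟨γ, hγ, hγ'⟩ : ∃ γ > 0, C * (‖u‖ * R + γ) = φ (α * R) :=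
    ⟨(φ (α * R) - C * (‖u‖ * R)) / C, div_pos (sub_pos.2 hu) hC, by field_simp; ring⟩
  have hex : ∀ e : ℝ, ∃ v, e ∈ Ioo 0 γ → f v ≤ ((sInf T + u v + e : ℝ) : EReal) ∧
      ∀ s, 0 < s → s ≤ τ * dist v z → φ s ≤ s * (κ * e) := by
    intro e
    by_cases he : e ∈ Ioo 0 γ
    swap
    · exact ⟨c, fun h => absurd h he⟩
    obtain ⟨t, ⟨w, hw, hwt⟩, ht⟩ := Real.lt_sInf_add_pos ⟨_, hcT⟩ he.1
    obtain ⟨v, hv, -, hfv, hvy⟩ := exists_clarkeSubdiff_near hbot hlsc u hm hw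
      (hwt.trans (EReal.coe_le_coe_iff.2 (by linarith))) he.1 one_pos
    have hvb : v ∈ Metric.ball c R := by
      by_contra hvb
      have hvR : ‖v - c‖ = R := by
        rw [← dist_eq_norm]
        exact le_antisymm hv (not_lt.1 hvb)
      have hvr := EReal.coe_toReal (ne_top_of_le_ne_top (EReal.coe_ne_top _) hfv) (hbot v)
      have h1 := hgrowth v hv _ hvr.symm
      rw [hvR, ← hγ'] at h1
      have h2 := le_of_mul_le_mul_left h1 hC
      rw [← hvr, EReal.coe_le_coe_iff] at hfv
      linarith [hux v hv, csInf_le hTb hcT, he.2]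
    obtain ⟨y, hy, hyu⟩ := hvy hvb
    rw [div_one] at hyu
    exact ⟨v, fun _ => ⟨hfv, fun s hs hsv => hreg v hvb y hy e s hyu hs hsv⟩⟩
  choose v hv using hex
  have hev : ∀ᶠ e in 𝓝[>] (0 : ℝ), e ∈ Ioo 0 γ := Ioo_mem_nhdsGT hγ
  have hvz : Tendsto v (𝓝[>] 0) (𝓝 z) := by
    refine Metric.tendsto_nhds.2 fun ρ hρ => ?_
    have hτρ : 0 < τ * ρ := mul_pos hτ hρ
    have hlt : ∀ᶠ e in 𝓝[>] (0 : ℝ), τ * ρ * (κ * e) < φ (τ * ρ) := by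
      refine Tendsto.eventually_lt_const (v := τ * ρ * (κ * 0)) (by simpa using hφ.pos hτρ) ?_
      exact ((by fun_prop : Continuous fun e : ℝ => τ * ρ * (κ * e)).tendsto 0).mono_left
        nhdsWithin_le_nhds
    filter_upwards [hev, hlt] with e he hlt
    by_contra! hd
    exact hlt.not_ge ((hv e he).2 _ hτρ (mul_le_mul_of_nonneg_left hd hτ.le))
  have hfz : f z ≤ ((sInf T + u z + 0 : ℝ) : EReal) := by
    have hlim : Tendsto (fun e => (v e, ((sInf T + u (v e) + e : ℝ) : EReal))) (𝓝[>] (0 : ℝ))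
        (𝓝 (z, ((sInf T + u z + 0 : ℝ) : EReal))) := by
      refine hvz.prodMk_nhds ((continuous_coe_real_ereal.tendsto _).comp ?_)
      exact (((u.continuous.tendsto z).comp hvz).const_add _).add
        (tendsto_id.mono_left nhdsWithin_le_nhds)
    refine (lowerSemicontinuous_iff_isClosed_epigraph.1 hlsc).mem_of_tendsto hlim ?_
    filter_upwards [hev] with e he using (hv e he).1
  calc f z + ((u (x - z) : ℝ) : EReal)
      ≤ ((sInf T + u z + 0 : ℝ) : EReal) + ((u (x - z) : ℝ) : EReal) := add_le_add_left hfz _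
    _ = ((sInf T + u x : ℝ) : EReal) := by
      rw [← EReal.coe_add, map_sub]
      congr 1
      ring
    _ ≤ f x := hm x hx

end TiltStability

/-! ### Proof of the theorem -/

open TiltStability

theorem theorem3p3 {X : Type*} [NormedAddCommGroup X] [NormedSpace ℝ X] [CompleteSpace X]
    (φ : ℝ → ℝ) (hφ : TiltStability.IsAdmissible φ) (hconv : ConvexOn ℝ (Set.Ici (0 : ℝ)) φ)
    (f : X → EReal) (hproper : TiltStability.IsProper f) (hlsc : LowerSemicontinuous f)
    (xbar : X) (hdom : f xbar ≠ ⊤) (hmin : IsLocalMin f xbar)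
    (hreg : TiltStability.StronglyMetricallyRegular (TiltStability.rightDeriv φ)
      (TiltStability.clarkeSubdiff f) xbar 0) :
    TiltStability.HasSLWP φ f xbar := by
  obtain ⟨hbot, -⟩ := hproper
  obtain ⟨h0mem, r, τ, κ, δ, hr, hτ, hκ, hδ, hineq, hsing⟩ := hreg
  have hψ : ∀ s t, 0 < s → s ≤ t → φ s ≤ s * rightDeriv φ t := fun s t hs hst =>
    le_mul_rightDeriv hconv hφ.map_zero hs hst
  obtain ⟨a, ha⟩ : ∃ a : ℝ, f xbar = a := ⟨_, (EReal.coe_toReal hdom (hbot xbar)).symm⟩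
  obtain ⟨μ, hμ, hμmin⟩ := Metric.eventually_nhds_iff.1 hmin
  -- The growth lemma shrinks the radius by 3 and is used twice: from `9ρ` to `3ρ` at `xbar`, then
  -- from `3ρ` to `ρ` at `s u`.
  obtain ⟨ρ, hρ, hρr, hρδ, hρμ⟩ : ∃ ρ > 0, 9 * ρ < r ∧ 9 * ρ ≤ δ / 3 ∧ 9 * ρ < μ := by
    have h1 := min_le_left r (min δ μ)
    have h2 := (min_le_right r (min δ μ)).trans (min_le_left δ μ)
    have h3 := (min_le_right r (min δ μ)).trans (min_le_right δ μ)
    have h4 : 0 < min r (min δ μ) := lt_min hr (lt_min hδ hμ)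
    exact ⟨min r (min δ μ) / 27, by linarith, by linarith, by linarith, by linarith⟩
  have hsing' : ∀ u : StrongDual ℝ X, ∃ z, u ∈ Metric.ball 0 r →
      {x | u ∈ clarkeSubdiff f x} ∩ Metric.ball xbar δ = {z} := by
    intro u
    by_cases hu : u ∈ Metric.ball 0 r
    · obtain ⟨z, hz⟩ := hsing u hu
      exact ⟨z, fun _ => hz⟩
    · exact ⟨xbar, fun h => absurd h hu⟩
  choose s hs using hsing'
  have hs0 : s 0 = xbar :=
    ((hs 0 (Metric.mem_ball_self hr)).le ⟨h0mem, Metric.mem_ball_self hδ⟩).symm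
  have hcrit : ∀ u ∈ Metric.ball (0 : StrongDual ℝ X) r, dist (s u) xbar ≤ δ / 3 →
      ∀ v ∈ Metric.ball xbar (9 * ρ), ∀ y ∈ clarkeSubdiff f v, ∀ ε t, ‖y - u‖ ≤ ε → 0 < t →
        t ≤ τ * dist v (s u) → φ t ≤ t * (κ * ε) := by
    intro u hu hsu v hv y hy ε t hyu ht htv
    rw [Metric.mem_ball] at hv
    exact (hineq v (hv.trans hρr) u hu).le_of_mem hψ hτ hκ (hs u hu) (hv.le.trans hρδ) hsu hy hyu
      ht htv
  have hgrowth : ∀ x ∈ Metric.closedBall xbar (3 * ρ), ∀ b : ℝ, f x = b →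
      φ (τ / 2 * ‖x - xbar‖) ≤ τ * κ * (b - a) := by
    intro x hx b hb
    have h := growth_of_isMinOn hbot hlsc hφ.map_zero (R := 3 * ρ) (c := xbar) (z := xbar)
      (by positivity) hτ hκ 0
      (fun v hv y hy ε t hyu ht htv => hcrit 0 (Metric.mem_ball_self hr)
        (by rw [hs0, dist_self]; positivity) v (by rwa [show 9 * ρ = 3 * (3 * ρ) by ring]) y hy ε t
        hyu ht (by rwa [hs0]))
      (Metric.mem_closedBall_self (by positivity)) ha (fun x hx => by
        rw [Metric.mem_closedBall] at hx
        simpa [ha] using hμmin (y := x) (by linarith)) hx hb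
    simpa using h
  -- The first threshold forces `dist (s u) xbar < ρ`; the second lets growth at `xbar` beat the
  -- tilt on the sphere of radius `3ρ`.
  obtain ⟨δ', hδ', hδr, hδ1, hδ2⟩ : ∃ δ' > 0, δ' ≤ r ∧
      (∀ t < δ', τ * ρ * (κ * t) < φ (τ * ρ)) ∧
      ∀ t < δ', τ * κ * (t * (3 * ρ)) < φ (τ / 2 * (3 * ρ)) := by
    have h1 : 0 < φ (τ * ρ) := hφ.pos (by positivity)
    have h2 : 0 < φ (τ / 2 * (3 * ρ)) := hφ.pos (by positivity)
    refine ⟨min r (min (φ (τ * ρ) / (τ * ρ * κ)) (φ (τ / 2 * (3 * ρ)) / (τ * κ * (3 * ρ)))),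
      by positivity, min_le_left _ _, fun t ht => ?_, fun t ht => ?_⟩
    · have := (lt_min_iff.1 (lt_min_iff.1 ht).2).1
      rw [lt_div_iff₀ (by positivity)] at this
      linarith
    · have := (lt_min_iff.1 (lt_min_iff.1 ht).2).2
      rw [lt_div_iff₀ (by positivity)] at this
      linarith
  refine ⟨hdom, δ', ρ, τ * κ, τ / 2, hδ', hρ, by positivity, by positivity, s, hs0, fun u hu => ?_⟩
  have hur : u ∈ Metric.ball (0 : StrongDual ℝ X) r := Metric.ball_subset_ball hδr hu
  have hu' : ‖u‖ < δ' := by simpa using hu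
  have hsu : dist (s u) xbar < ρ :=
    (hineq xbar (Metric.mem_ball_self hr) u hur).dist_lt hψ hτ hκ (hs u hur) h0mem hρ
      (by linarith) (by simpa using hδ1 _ hu')
  have hcrit' := hcrit u hur (by linarith)
  have hsub3 : Metric.ball xbar (3 * ρ) ⊆ Metric.ball xbar (9 * ρ) :=
    Metric.ball_subset_ball (by linarith)
  have hsumin : ∀ x ∈ Metric.closedBall xbar (3 * ρ),
      f (s u) + ((u (x - s u) : ℝ) : EReal) ≤ f x := fun x hx =>
    isMinOn_of_growth hbot hlsc hφ (by positivity) hτ (half_pos hτ) (mul_pos hτ hκ) u ha hgrowth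
      (hδ2 _ hu') (fun v hv => hcrit' v (hsub3 hv)) hx
  have hsutop : f (s u) ≠ ⊤ := ((hs u hur).ge rfl).1.1
  obtain ⟨b, hb⟩ : ∃ b : ℝ, f (s u) = b := ⟨_, (EReal.coe_toReal hsutop (hbot _)).symm⟩
  refine ⟨hsu.le, hsutop, fun x hx => ?_⟩
  rw [tilt, tilt, hb, ← EReal.coe_sub]
  by_cases hxtop : f x = ⊤
  · rw [hxtop, EReal.top_sub_coe, EReal.top_sub_coe, EReal.coe_mul_top_of_pos (by positivity)]
    exact le_top
  · obtain ⟨q, hq⟩ : ∃ q : ℝ, f x = q := ⟨_, (EReal.coe_toReal hxtop (hbot _)).symm⟩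
    rw [hq, ← EReal.coe_sub, ← EReal.coe_sub, ← EReal.coe_mul, EReal.coe_le_coe_iff]
    exact growth_of_isMinOn hbot hlsc hφ.map_zero hρ hτ hκ u (fun v hv => hcrit' v (hsub3 hv))
      hsu.le hb (fun x hx => by simpa [hb] using hsumin x hx) hx hq
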